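/- Theorem 5.1 (two-by-two kernel CLT). Let $a^*,b^*,c^*>0$ with $a^*c^*-(b^*)^2\ge 0$, let $L^*=\begin{pmatrix}a^*&b^*\\ b^*&c^*\end{pmatrix}$, and let $Z_1,Z_2,\dots$ be independent random subsets of $\{1,2\}$ with law $\mathbb P(Z_i=J)=p_{L^*}(J)=\det(L^*_J)/\det(L^*+I)$ for all $J\subseteq\{1,2\}$ (where $\det(L^*_\emptyset)=1$). Let $p_1,p_2,p_3$ be the probabilities $p_{L^*}(J)$ of $J=\{1\},\{2\},\{1,2\}$, let $\hat p_0,\hat p_1,\hat p_2,\hat p_3$ be the empirical frequencies of $\emptyset,\{1\},\{2\},\{1,2\}$ in the sample $Z_1,\dots,Z_n$, and let $$(\hat a,\hat b,\hat c)=\Big(\frac{\hat p_1}{\hat p_0},\ \frac{\sqrt{\hat p_1\hat p_2-\hat p_0\hat p_3}}{\hat p_0},\ \frac{\hat p_2}{\hat p_0}\Big)$$ (a quotient with $\hat p_0=0$ and the square root of a negative number are read as $0$). Then almost surely, for all sufficiently large $n$, $\hat p_0>0$ and $\hat p_1\hat p_2-\hat p_0\hat p_3\ge0$, and, as $n\to\infty$,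 $$\sqrt n\big((\hat a,\hat b,\hat c)-(a^*,b^*,c^*)\big)\xrightarrow{\ d\ }\mathcal N(\mathbf 0,\Sigma),$$ where $\Sigma$ is the positive semidefinite matrix $$\Sigma=D\begin{pmatrix}a^*+(a^*)^2&\sigma_{12}&\sigma_{13}\\ \sigma_{12}&\frac14\Big(\frac{a^*c^*}{(b^*)^2}-1\Big)D+\frac{a^*+c^*+4a^*c^*}{4}&\sigma_{23}\\ \sigma_{13}&\sigma_{23}&c^*+(c^*)^2\end{pmatrix},$$ with $D=(a^*+1)(c^*+1)-(b^*)^2$, $\sigma_{12}=\frac{a^*c^*}{2b^*}+a^*b^*+\frac{a^*}{2b^*}(a^*c^*-(b^*)^2)$, $\sigma_{13}=a^*c^*$, $\sigma_{23}=\frac{a^*c^*}{2b^*}+b^*c^*+\frac{c^*}{2b^*}(a^*c^*-(b^*)^2)$. Let $\Phi(a,b,c)=\sum_{J\subseteq\{1,2\}}p_{L^*}(J)\log\det(L_J)-\log\det(L+I)$ with $L=\begin{pmatrix}a&b\\ b&c\end{pmatrix}$ be the expected log-likelihood; explicitly, $$\Phi(a,b,c)=p_1\log a+p_2\log c+p_3\log(ac-b^2)-\log[(a+1)(c+1)-b^2].$$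 If moreover $L^*$ is positive definite, that is, $a^*c^*-(b^*)^2>0$, then $\Phi$ is twice continuously differentiable near $(a^*,b^*,c^*)$, its Hessian matrix there is invertible, and the inverse $V(a^*,b^*,c^*)$ of this Hessian satisfies $-V(a^*,b^*,c^*)=\Sigma$; hence $$\sqrt n\big((\hat a,\hat b,\hat c)-(a^*,b^*,c^*)\big)\xrightarrow{\ d\ }\mathcal N\big(\mathbf 0,-V(a^*,b^*,c^*)\big).$$ -/

import Mathlib

open MeasureTheory ProbabilityTheory Filter Topology

noncomputable section

namespace DPP

/-- The probability `p_L(J) = det(L_J) / det(L + I)` that the L-ensemble with kernel `L` on the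
ground set `[N]` assigns to the subset `J`; `L_J` is the principal submatrix of `L` indexed by
`J` (and the determinant of the empty matrix is `1`). -/
def prob {N : ℕ} (L : Matrix (Fin N) (Fin N) ℝ) (J : Finset (Fin N)) : ℝ :=
  (L.submatrix (fun i : {x // x ∈ J} => (i : Fin N)) (fun i : {x // x ∈ J} => (i : Fin N))).det /
    (L + 1).det

/-- `Z 0, Z 1, …` are independent random subsets of `[N]`, each distributed as the L-ensemble
with kernel `L`. The first `n` of them form a sample of size `n` from `DPP(L)`. -/
structure IsSample {N : ℕ} {Ω : Type*} [MeasurableSpace Ω] (P : Measure Ω)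
    (L : Matrix (Fin N) (Fin N) ℝ) (Z : ℕ → Ω → Finset (Fin N)) : Prop where
  measurable : ∀ i, Measurable (Z i)
  indep : iIndepFun Z P
  law : ∀ i J, P.real {ω | Z i ω = J} = prob L J

/-- The empirical probability `p̂(J) = (1/n) ∑_{i ≤ n} 𝟙(Z_i = J)`. -/
def empProb {N : ℕ} {Ω : Type*} (Z : ℕ → Ω → Finset (Fin N)) (n : ℕ) (J : Finset (Fin N))
    (ω : Ω) : ℝ :=
  (1 / (n : ℝ)) * ∑ i ∈ Finset.range n, if Z i ω = J then (1 : ℝ) else 0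

/-- The expected log-likelihood
`Φ_{L⋆}(L) = ∑_J p_{L⋆}(J) log det(L_J) - log det(L + I)`. -/
def expLogLik {N : ℕ} (Lstar L : Matrix (Fin N) (Fin N) ℝ) : ℝ :=
  ∑ J : Finset (Fin N), prob Lstar J *
      Real.log (L.submatrix (fun i : {x // x ∈ J} => (i : Fin N))
        (fun i : {x // x ∈ J} => (i : Fin N))).det -
    Real.log (L + 1).det

/-- The symmetric two-by-two kernel with entries `a, b, b, c`. -/
def kernel (a b c : ℝ) : Matrix (Fin 2) (Fin 2) ℝ :=
  !![a, b; b, c]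

/-- The expected log-likelihood of the two-by-two model as a function of `θ = (a, b, c)`, the
true kernel being `kernel as bs cs`. -/
def expLogLik₂ (as bs cs : ℝ) (θ : EuclideanSpace ℝ (Fin 3)) : ℝ :=
  expLogLik (kernel as bs cs) (kernel (θ 0) (θ 1) (θ 2))

/-- The Hessian matrix `(∂ᵢ ∂ⱼ f (x))ᵢⱼ` of `f`. -/
def hessian {ι : Type*} [Fintype ι] [DecidableEq ι] (f : EuclideanSpace ℝ ι → ℝ)
    (x : EuclideanSpace ℝ ι) : Matrix ι ι ℝ :=
  Matrix.of fun i j =>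
    fderiv ℝ (fun y => fderiv ℝ f y (EuclideanSpace.single j 1)) x (EuclideanSpace.single i 1)

/-- `V(a⋆, b⋆, c⋆)`: the inverse of the Hessian of the expected log-likelihood at the true
parameter. -/
def invHessian (as bs cs : ℝ) : Matrix (Fin 3) (Fin 3) ℝ :=
  (hessian (expLogLik₂ as bs cs) !₂[as, bs, cs])⁻¹

/-- The radicand `p̂₁ p̂₂ - p̂₀ p̂₃`, where `p̂₀, p̂₁, p̂₂, p̂₃` are the empirical probabilities of
the empty set, of the singleton of the first item, of the singleton of the second item, and of
the full ground set. -/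
def radicand {Ω : Type*} (Z : ℕ → Ω → Finset (Fin 2)) (n : ℕ) (ω : Ω) : ℝ :=
  empProb Z n {0} ω * empProb Z n {1} ω - empProb Z n ∅ ω * empProb Z n {0, 1} ω

/-- The estimator `(â, b̂, ĉ) = (p̂₁ / p̂₀, √(p̂₁ p̂₂ - p̂₀ p̂₃) / p̂₀, p̂₂ / p̂₀)`. (Where `p̂₀ = 0`
the quotients are `0`, and the square root of a negative number is `0`.) -/
def estimator {Ω : Type*} (Z : ℕ → Ω → Finset (Fin 2)) (n : ℕ) (ω : Ω) :
    EuclideanSpace ℝ (Fin 3) :=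
  !₂[empProb Z n {0} ω / empProb Z n ∅ ω,
     Real.sqrt (radicand Z n ω) / empProb Z n ∅ ω,
     empProb Z n {1} ω / empProb Z n ∅ ω]

/-- The explicit asymptotic covariance matrix of the estimator, with
`D = (a + 1)(c + 1) - b²`. -/
def asympCov (a b c : ℝ) : Matrix (Fin 3) (Fin 3) ℝ :=
  let D : ℝ := (a + 1) * (c + 1) - b ^ 2
  let σ₁₂ : ℝ := a * c / (2 * b) + a * b + a / (2 * b) * (a * c - b ^ 2)
  let σ₁₃ : ℝ := a * c
  let σ₂₃ : ℝ := a * c / (2 * b) + b * c + c / (2 * b) * (a * c - b ^ 2)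
  D • !![a + a ^ 2, σ₁₂, σ₁₃;
         σ₁₂, (a * c / b ^ 2 - 1) / 4 * D + (a + c + 4 * a * c) / 4, σ₂₃;
         σ₁₃, σ₂₃, c + c ^ 2]

end DPP

end

/-! The estimator is a smooth function of the empirical frequencies, so this is a delta method, made
exact. Write `p₀, p₁, p₂, p₃` for the empirical frequencies, `s = √(p₁p₂ - p₀p₃)` and `D = det(L +
I)`. The errors of `â` and `ĉ` are linear forms in the frequencies divided by `p₀`. For `b̂`,
rationalizing gives `s - b p₀ = (s² - b² p₀²) / (s + b p₀)`, where `s² - b² p₀² = p₀ (c p₁ + a p₂ -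
p₃ - (ac + b²) p₀) + (p₁ - a p₀)(p₂ - c p₀)`. So the normalized error is `errorMap` of a normalized
sum of iid centred vectors (`influence`) and random coefficients (`sqrt_smul_estimator_sub`). The
coefficients tend almost surely to `(1, 1, 0)`, where `errorMap` is the identity in its first
argument; the central limit theorem and Slutsky's theorem give the limit. Its covariance is that of
`influence`, which also shows that it is positive semidefinite.

A singular kernel causes no trouble, since the radicand tends to `(b / D)² > 0`. Only the likelihood
part, with its term `log(ac - b²)`, needs a positive determinant. There the Hessian is computed in
closed form and multiplied by `-Σ` (`hessian_mul_neg_asympCov`). -/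

open scoped Matrix in
/-- The multivariate central limit theorem for centred independent identically distributed
vectors. -/
theorem tendstoInDistribution_inv_sqrt_smul_sum_multivariateGaussian
    {ι Ω : Type*} [Fintype ι] [DecidableEq ι] [MeasurableSpace Ω] {P : Measure Ω}
    [IsProbabilityMeasure P] {X : ℕ → Ω → EuclideanSpace ℝ ι} {S : Matrix ι ι ℝ}
    (hS : S.PosSemidef) (hX : MemLp (X 0) 2 P)
    (hmean : ∀ t, ∫ ω, inner ℝ (X 0 ω) t ∂P = 0)
    (hcov : ∀ t : EuclideanSpace ℝ ι, ∫ ω, (inner ℝ (X 0 ω) t) ^ 2 ∂P = t ⬝ᵥ S *ᵥ t)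
    (hindep : iIndepFun X P) (hident : ∀ i, IdentDistrib (X i) (X 0) P P) :
    TendstoInDistribution (fun (n : ℕ) ω ↦ (Real.sqrt n)⁻¹ • ∑ k ∈ Finset.range n, X k ω)
      atTop id (fun _ ↦ P) (multivariateGaussian 0 S) where
  forall_aemeasurable n :=
    (Finset.aemeasurable_fun_sum _ fun _ _ ↦ (hident _).aemeasurable_fst).fun_const_smul _
  tendsto := by
    refine ProbabilityMeasure.tendsto_iff_tendsto_charFun.2 fun t ↦ ?_
    have hm : Measurable fun x : EuclideanSpace ℝ ι ↦ inner ℝ x t := by fun_prop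
    have haem (i : ℕ) : AEMeasurable (X i) P := (hident i).aemeasurable_fst
    set Y : ℕ → Ω → ℝ := fun i ω ↦ inner ℝ (X i ω) t with hY
    have hYmem : MemLp (Y 0) 2 P := hX.inner_const t
    have hvar : Var[Y 0; P] = t ⬝ᵥ S *ᵥ t := by
      rw [variance_of_integral_eq_zero hYmem.aemeasurable (hmean t), ← hcov t]
    -- Cramér–Wold: the characteristic function at `t` is that of the projection onto `t` at
    -- frequency `1`, so the real central limit theorem suffices.
    have key := tendstoInDistribution_inv_sqrt_mul_sum_sub (P := P) (X := Y)
      (P' := gaussianReal 0 Var[Y 0; P].toNNReal) (Y := id) HasLaw.id hYmem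
      (hindep.comp (fun _ x ↦ inner ℝ x t) fun _ ↦ hm) fun i ↦ (hident i).comp hm
    have h1 := ProbabilityMeasure.tendsto_iff_tendsto_charFun.1 key.tendsto 1
    have hlim : charFun (multivariateGaussian 0 S) t =
        charFun (gaussianReal 0 Var[Y 0; P].toNNReal) 1 := by
      rw [charFun_multivariateGaussian hS, charFun_gaussianReal]
      have : ((Var[Y 0; P].toNNReal : ℝ) : ℂ) = ((t ⬝ᵥ S *ᵥ t : ℝ) : ℂ) := by
        rw [Real.coe_toNNReal _ (variance_nonneg _ _), hvar]
      rw [this]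
      simp
    simp only [ProbabilityMeasure.coe_mk, Measure.map_id] at h1 ⊢
    rw [hlim]
    refine h1.congr fun n ↦ ?_
    have hsum : AEMeasurable (fun ω ↦ ∑ k ∈ Finset.range n, X k ω) P :=
      Finset.aemeasurable_fun_sum _ fun _ _ ↦ haem _
    have hsumY : AEMeasurable (fun ω ↦ ∑ k ∈ Finset.range n, Y k ω) P :=
      Finset.aemeasurable_fun_sum _ fun _ _ ↦ hm.comp_aemeasurable (haem _)
    rw [charFun_apply, charFun_apply, integral_map (by fun_prop) (by fun_prop),
      integral_map (by fun_prop) (by fun_prop)]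
    refine integral_congr_ae (ae_of_all _ fun ω ↦ ?_)
    simp [hmean t, real_inner_smul_left, sum_inner, hY]

namespace DPP

/-! ### Samples and empirical frequencies -/

theorem IsSample.map_apply_singleton {N : ℕ} {Ω : Type*} [MeasurableSpace Ω] {P : Measure Ω}
    {L : Matrix (Fin N) (Fin N) ℝ} {Z : ℕ → Ω → Finset (Fin N)} (hZ : IsSample P L Z)
    (i : ℕ) (J : Finset (Fin N)) : (P.map (Z i)).real {J} = prob L J := by
  rw [measureReal_def, Measure.map_apply (hZ.measurable i) (measurableSet_singleton J),
    ← measureReal_def, ← hZ.law i J]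
  rfl

theorem IsSample.identDistrib {N : ℕ} {Ω : Type*} [MeasurableSpace Ω] {P : Measure Ω}
    [IsProbabilityMeasure P] {L : Matrix (Fin N) (Fin N) ℝ} {Z : ℕ → Ω → Finset (Fin N)}
    (hZ : IsSample P L Z) (i j : ℕ) : IdentDistrib (Z i) (Z j) P P where
  aemeasurable_fst := (hZ.measurable i).aemeasurable
  aemeasurable_snd := (hZ.measurable j).aemeasurable
  map_eq := by
    have := Measure.isProbabilityMeasure_map (μ := P) (hZ.measurable i).aemeasurable
    have := Measure.isProbabilityMeasure_map (μ := P) (hZ.measurable j).aemeasurable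
    refine Measure.ext_of_singleton fun J ↦ ?_
    rw [← measureReal_eq_measureReal_iff, hZ.map_apply_singleton, hZ.map_apply_singleton]

theorem IsSample.integral_comp {N : ℕ} {Ω : Type*} [MeasurableSpace Ω] {P : Measure Ω}
    [IsProbabilityMeasure P] {L : Matrix (Fin N) (Fin N) ℝ} {Z : ℕ → Ω → Finset (Fin N)}
    (hZ : IsSample P L Z) (i : ℕ) (f : Finset (Fin N) → ℝ) :
    ∫ ω, f (Z i ω) ∂P = ∑ J, prob L J * f J := by
  have := Measure.isProbabilityMeasure_map (μ := P) (hZ.measurable i).aemeasurable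
  rw [← integral_map (hZ.measurable i).aemeasurable
    (measurable_of_countable f).aestronglyMeasurable, integral_fintype .of_finite]
  simp [hZ.map_apply_singleton]

theorem IsSample.tendsto_empProb {N : ℕ} {Ω : Type*} [MeasurableSpace Ω] {P : Measure Ω}
    [IsProbabilityMeasure P] {L : Matrix (Fin N) (Fin N) ℝ} {Z : ℕ → Ω → Finset (Fin N)}
    (hZ : IsSample P L Z) (J : Finset (Fin N)) :
    ∀ᵐ ω ∂P, Tendsto (fun n ↦ empProb Z n J ω) atTop (𝓝 (prob L J)) := by
  have hm : Measurable fun K : Finset (Fin N) ↦ if K = J then (1 : ℝ) else 0 :=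
    measurable_of_countable _
  have := strong_law_ae_real (μ := P) (fun i ω ↦ if Z i ω = J then (1 : ℝ) else 0)
    (.of_bound (hm.comp (hZ.measurable 0)).aestronglyMeasurable 1
      (ae_of_all _ fun ω ↦ by split_ifs <;> simp))
    (fun i j hij ↦ (hZ.indep.indepFun hij).comp hm hm)
    fun i ↦ (hZ.identDistrib i 0).comp hm
  filter_upwards [this] with ω hω
  rw [hZ.integral_comp 0 (fun K ↦ if K = J then (1 : ℝ) else 0)] at hω
  simpa [empProb, div_eq_inv_mul] using hω

theorem IsSample.measurable_empProb {N : ℕ} {Ω : Type*} [MeasurableSpace Ω] {P : Measure Ω}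
    {L : Matrix (Fin N) (Fin N) ℝ} {Z : ℕ → Ω → Finset (Fin N)}
    (hZ : IsSample P L Z) (n : ℕ) (J : Finset (Fin N)) : Measurable (empProb Z n J) :=
  (Finset.measurable_fun_sum _ fun i _ ↦
    (measurable_of_countable fun K : Finset (Fin N) ↦ if K = J then (1 : ℝ) else 0).comp
      (hZ.measurable i)).const_mul _

/-! ### Probabilities and influence function of the two-by-two model -/

theorem univ_finset_fin_two :
    (Finset.univ : Finset (Finset (Fin 2))) = {∅, {0}, {1}, {0, 1}} := by
  decide

/-- A sum over the subsets of a two-element ground set. -/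
theorem sum_finset_fin_two (f : Finset (Fin 2) → ℝ) :
    ∑ J, f J = f ∅ + f {0} + f {1} + f {0, 1} := by
  rw [univ_finset_fin_two, Finset.sum_insert (by decide), Finset.sum_insert (by decide),
    Finset.sum_insert (by decide), Finset.sum_singleton]
  ring

theorem det_submatrix_singleton {N : ℕ} (L : Matrix (Fin N) (Fin N) ℝ) (i : Fin N) :
    (L.submatrix (fun j : {x // x ∈ ({i} : Finset (Fin N))} => (j : Fin N))
      (fun j : {x // x ∈ ({i} : Finset (Fin N))} => (j : Fin N))).det = L i i := by
  rw [Matrix.det_eq_elem_of_subsingleton _ ⟨i, Finset.mem_singleton_self i⟩]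
  rfl

theorem det_kernel (a b c : ℝ) : (kernel a b c).det = a * c - b ^ 2 := by
  rw [kernel, Matrix.det_fin_two_of]
  ring

theorem det_submatrix_pair (L : Matrix (Fin 2) (Fin 2) ℝ) :
    (L.submatrix (fun j : {x // x ∈ ({0, 1} : Finset (Fin 2))} => (j : Fin 2))
      (fun j : {x // x ∈ ({0, 1} : Finset (Fin 2))} => (j : Fin 2))).det = L.det :=
  Matrix.det_submatrix_equiv_self (Equiv.subtypeUnivEquiv (by decide)) L

theorem det_kernel_add_one (a b c : ℝ) :
    (kernel a b c + 1).det = (a + 1) * (c + 1) - b ^ 2 := by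
  simp [kernel, Matrix.det_fin_two]
  ring

section prob
variable (a b c : ℝ)

theorem prob_kernel_empty : prob (kernel a b c) ∅ = 1 / ((a + 1) * (c + 1) - b ^ 2) := by
  rw [prob, det_kernel_add_one, Matrix.det_isEmpty]

theorem prob_kernel_zero : prob (kernel a b c) {0} = a / ((a + 1) * (c + 1) - b ^ 2) := by
  rw [prob, det_kernel_add_one, det_submatrix_singleton]
  rfl

theorem prob_kernel_one : prob (kernel a b c) {1} = c / ((a + 1) * (c + 1) - b ^ 2) := by
  rw [prob, det_kernel_add_one, det_submatrix_singleton]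
  rfl

theorem prob_kernel_pair :
    prob (kernel a b c) {0, 1} = (a * c - b ^ 2) / ((a + 1) * (c + 1) - b ^ 2) := by
  rw [prob, det_kernel_add_one, det_submatrix_pair, det_kernel]

theorem expLogLik₂_eq (θ : EuclideanSpace ℝ (Fin 3)) : expLogLik₂ a b c θ =
    prob (kernel a b c) {0} * Real.log (θ 0) + prob (kernel a b c) {1} * Real.log (θ 2) +
      prob (kernel a b c) {0, 1} * Real.log (θ 0 * θ 2 - θ 1 ^ 2) -
      Real.log ((θ 0 + 1) * (θ 2 + 1) - θ 1 ^ 2) := by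
  rw [expLogLik₂, expLogLik, sum_finset_fin_two, det_kernel_add_one, det_submatrix_singleton,
    det_submatrix_singleton, det_submatrix_pair, det_kernel, Matrix.det_isEmpty, Real.log_one,
    mul_zero, zero_add]
  rfl

/-- The indicator of `J = K`. -/
noncomputable def ind {N : ℕ} (K J : Finset (Fin N)) : ℝ := if J = K then 1 else 0

/-- The influence function of the estimator at the kernel with entries `a, b, b, c`. -/
noncomputable def influence (J : Finset (Fin 2)) : EuclideanSpace ℝ (Fin 3) :=
  let D : ℝ := (a + 1) * (c + 1) - b ^ 2
  !₂[D * (ind {0} J - a * ind ∅ J),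
     D / (2 * b) * (c * ind {0} J + a * ind {1} J - ind {0, 1} J - (a * c + b ^ 2) * ind ∅ J),
     D * (ind {1} J - c * ind ∅ J)]

theorem influence_empty : influence a b c ∅ = !₂[-((a + 1) * (c + 1) - b ^ 2) * a,
    -((a + 1) * (c + 1) - b ^ 2) / (2 * b) * (a * c + b ^ 2),
    -((a + 1) * (c + 1) - b ^ 2) * c] := by
  ext i; fin_cases i <;>
    simp [influence, ind, show ((∅ : Finset (Fin 2)) = {0, 1}) ↔ False by decide] <;> ring

theorem influence_zero : influence a b c {0} = !₂[(a + 1) * (c + 1) - b ^ 2,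
    ((a + 1) * (c + 1) - b ^ 2) / (2 * b) * c, 0] := by
  ext i; fin_cases i <;>
    simp [influence, ind, show (({0} : Finset (Fin 2)) = {0, 1}) ↔ False by decide]

theorem influence_one : influence a b c {1} = !₂[0,
    ((a + 1) * (c + 1) - b ^ 2) / (2 * b) * a, (a + 1) * (c + 1) - b ^ 2] := by
  ext i; fin_cases i <;>
    simp [influence, ind, show (({1} : Finset (Fin 2)) = {0, 1}) ↔ False by decide]

theorem influence_pair : influence a b c {0, 1} = !₂[0,
    -((a + 1) * (c + 1) - b ^ 2) / (2 * b), 0] := by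
  ext i; fin_cases i <;>
    simp [influence, ind, show (({0, 1} : Finset (Fin 2)) = {0}) ↔ False by decide,
      show (({0, 1} : Finset (Fin 2)) = {1}) ↔ False by decide,
      show (({0, 1} : Finset (Fin 2)) = ∅) ↔ False by decide]
  ring

end prob

variable {a b c : ℝ}

/-- The normalization equals `(ac - b²) + a + c + 1`. -/
theorem normalization_pos (ha : 0 < a) (hc : 0 < c) (hdet : 0 ≤ a * c - b ^ 2) :
    0 < (a + 1) * (c + 1) - b ^ 2 := by
  nlinarith

/-- The true probabilities are proportional to `1, a, c, ac - b²`, and each linear form in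
`influence` vanishes on this vector. -/
theorem sum_prob_mul_inner_influence (hD : (a + 1) * (c + 1) - b ^ 2 ≠ 0) (hb : b ≠ 0)
    (t : EuclideanSpace ℝ (Fin 3)) :
    ∑ J, prob (kernel a b c) J * inner ℝ (influence a b c J) t = 0 := by
  rw [sum_finset_fin_two, prob_kernel_empty, prob_kernel_zero, prob_kernel_one, prob_kernel_pair,
    influence_empty, influence_zero, influence_one, influence_pair]
  simp only [PiLp.inner_apply, Fin.sum_univ_three]
  simp
  field_simp
  ring

open scoped Matrix in
theorem sum_prob_mul_inner_influence_sq (hD : (a + 1) * (c + 1) - b ^ 2 ≠ 0) (hb : b ≠ 0)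
    (t : EuclideanSpace ℝ (Fin 3)) :
    ∑ J, prob (kernel a b c) J * (inner ℝ (influence a b c J) t) ^ 2 =
      t ⬝ᵥ asympCov a b c *ᵥ t := by
  rw [sum_finset_fin_two, prob_kernel_empty, prob_kernel_zero, prob_kernel_one, prob_kernel_pair,
    influence_empty, influence_zero, influence_one, influence_pair]
  simp only [PiLp.inner_apply, Fin.sum_univ_three]
  simp [asympCov, dotProduct, Matrix.mulVec, Fin.sum_univ_three]
  field_simp
  ring

theorem prob_kernel_nonneg (ha : 0 < a) (hc : 0 < c) (hdet : 0 ≤ a * c - b ^ 2)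
    (J : Finset (Fin 2)) : 0 ≤ prob (kernel a b c) J := by
  have hD := normalization_pos ha hc hdet
  have hJ : J ∈ (Finset.univ : Finset (Finset (Fin 2))) := Finset.mem_univ J
  rw [univ_finset_fin_two] at hJ
  simp only [Finset.mem_insert, Finset.mem_singleton] at hJ
  rcases hJ with rfl | rfl | rfl | rfl
  · rw [prob_kernel_empty]; positivity
  · rw [prob_kernel_zero]; positivity
  · rw [prob_kernel_one]; positivity
  · rw [prob_kernel_pair]; positivity

/-- The quadratic form is the second moment of a projection of `influence`. -/
theorem posSemidef_asympCov (ha : 0 < a) (hb : 0 < b) (hc : 0 < c) (hdet : 0 ≤ a * c - b ^ 2) :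
    (asympCov a b c).PosSemidef := by
  refine Matrix.PosSemidef.of_dotProduct_mulVec_nonneg ?_ fun x ↦ ?_
  · ext i j
    fin_cases i <;> fin_cases j <;> simp [asympCov]
  · have := sum_prob_mul_inner_influence_sq (normalization_pos ha hc hdet).ne' hb.ne'
      (WithLp.toLp 2 x)
    simp only [star_trivial]
    rw [← this]
    exact Finset.sum_nonneg fun J _ ↦ mul_nonneg (prob_kernel_nonneg ha hc hdet J) (sq_nonneg _)

/-! ### The estimation error and its limit law -/

variable {Ω : Type*} {Z : ℕ → Ω → Finset (Fin 2)}

theorem inv_sqrt_smul_sum_influence (n : ℕ) (ω : Ω) :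
    (Real.sqrt n)⁻¹ • ∑ k ∈ Finset.range n, influence a b c (Z k ω) =
      Real.sqrt n • !₂[((a + 1) * (c + 1) - b ^ 2) * (empProb Z n {0} ω - a * empProb Z n ∅ ω),
        ((a + 1) * (c + 1) - b ^ 2) / (2 * b) * (c * empProb Z n {0} ω + a * empProb Z n {1} ω -
          empProb Z n {0, 1} ω - (a * c + b ^ 2) * empProb Z n ∅ ω),
        ((a + 1) * (c + 1) - b ^ 2) * (empProb Z n {1} ω - c * empProb Z n ∅ ω)] := by
  -- This includes `n = 0`, where both sides are `0`.
  have hs : (Real.sqrt n)⁻¹ = Real.sqrt n * (1 / (n : ℝ)) := by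
    rw [← Real.sqrt_div_self, div_eq_mul_one_div]
  rw [hs, mul_smul]
  congr 1
  ext i
  have he (J : Finset (Fin 2)) :
      empProb Z n J ω = 1 / n * ∑ k ∈ Finset.range n, ind J (Z k ω) := rfl
  simp only [he]
  fin_cases i <;>
  · simp [influence, ← Finset.mul_sum, Finset.sum_add_distrib, Finset.sum_sub_distrib]
    ring

/-- The coefficients that turn the normalized sum of influence functions into the normalized
estimation error. -/
noncomputable def errorCoeff (a b c : ℝ) (Z : ℕ → Ω → Finset (Fin 2)) (n : ℕ) (ω : Ω) :
    EuclideanSpace ℝ (Fin 3) :=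
  let D : ℝ := (a + 1) * (c + 1) - b ^ 2
  !₂[1 / (D * empProb Z n ∅ ω),
     2 * b / (D * (Real.sqrt (radicand Z n ω) + b * empProb Z n ∅ ω)),
     (empProb Z n {1} ω - c * empProb Z n ∅ ω) /
       (D * empProb Z n ∅ ω * (Real.sqrt (radicand Z n ω) + b * empProb Z n ∅ ω))]

/-- The action of the coefficients on the normalized sum of influence functions. -/
noncomputable def errorMap (x : EuclideanSpace ℝ (Fin 3) × EuclideanSpace ℝ (Fin 3)) :
    EuclideanSpace ℝ (Fin 3) :=
  !₂[x.2 0 * x.1 0, x.2 1 * x.1 1 + x.2 2 * x.1 0, x.2 0 * x.1 2]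

theorem continuous_errorMap : Continuous errorMap := by
  refine (PiLp.continuous_toLp 2 _).comp (continuous_pi fun i ↦ ?_)
  fin_cases i <;> simp <;> fun_prop

theorem sqrt_smul_estimator_sub (hb : 0 < b) (hD : (a + 1) * (c + 1) - b ^ 2 ≠ 0) {n : ℕ} {ω : Ω}
    (h0 : 0 < empProb Z n ∅ ω) (hR : 0 ≤ radicand Z n ω) :
    errorMap ((Real.sqrt n)⁻¹ • ∑ k ∈ Finset.range n, influence a b c (Z k ω),
      errorCoeff a b c Z n ω) = Real.sqrt n • (estimator Z n ω - !₂[a, b, c]) := by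
  rw [inv_sqrt_smul_sum_influence]
  have hsq := Real.sq_sqrt hR
  have hs := Real.sqrt_nonneg (radicand Z n ω)
  have hpos : 0 < Real.sqrt (radicand Z n ω) + b * empProb Z n ∅ ω := by positivity
  set s := Real.sqrt (radicand Z n ω)
  rw [radicand] at hsq
  ext i
  fin_cases i
  · simp [errorMap, errorCoeff, estimator]
    field_simp
  · simp only [errorMap, errorCoeff, estimator]
    simp
    rw [show √(radicand Z n ω) = s from rfl]
    field_simp
    -- The only non-formal input is `s² = p₁p₂ - p₀p₃`, which needs a nonnegative radicand.
    linear_combination -Real.sqrt n * hsq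
  · simp [errorMap, errorCoeff, estimator]
    field_simp

variable [MeasurableSpace Ω] {P : Measure Ω}

theorem IsSample.measurable_radicand (hZ : IsSample P (kernel a b c) Z) (n : ℕ) :
    Measurable (radicand Z n) :=
  ((hZ.measurable_empProb n _).mul (hZ.measurable_empProb n _)).sub
    ((hZ.measurable_empProb n _).mul (hZ.measurable_empProb n _))

theorem IsSample.measurable_estimator (hZ : IsSample P (kernel a b c) Z) (n : ℕ) :
    Measurable (estimator Z n) := by
  have h0 := hZ.measurable_empProb n ∅
  have h1 := hZ.measurable_empProb n {0}
  have h2 := hZ.measurable_empProb n {1}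
  have hR := hZ.measurable_radicand n
  refine (WithLp.measurable_toLp 2 _).comp (measurable_pi_lambda _ fun i ↦ ?_)
  fin_cases i <;> simp <;> fun_prop

theorem IsSample.measurable_errorCoeff (hZ : IsSample P (kernel a b c) Z) (n : ℕ) :
    Measurable (errorCoeff a b c Z n) := by
  have h0 := hZ.measurable_empProb n ∅
  have h2 := hZ.measurable_empProb n {1}
  have hR := hZ.measurable_radicand n
  refine (WithLp.measurable_toLp 2 _).comp (measurable_pi_lambda _ fun i ↦ ?_)
  fin_cases i <;> simp <;> fun_prop

variable [IsProbabilityMeasure P]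

theorem IsSample.tendstoInDistribution_influence (ha : 0 < a) (hb : 0 < b) (hc : 0 < c)
    (hdet : 0 ≤ a * c - b ^ 2) (hZ : IsSample P (kernel a b c) Z) :
    TendstoInDistribution
      (fun (n : ℕ) ω ↦ (Real.sqrt n)⁻¹ • ∑ k ∈ Finset.range n, influence a b c (Z k ω))
      atTop id (fun _ ↦ P) (multivariateGaussian 0 (asympCov a b c)) := by
  have hD := (normalization_pos ha hc hdet).ne'
  have hm : Measurable (influence a b c) := measurable_of_countable _
  refine tendstoInDistribution_inv_sqrt_smul_sum_multivariateGaussian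
    (X := fun k ω ↦ influence a b c (Z k ω)) (posSemidef_asympCov ha hb hc hdet) ?_ ?_ ?_
    (hZ.indep.comp _ fun _ ↦ hm) fun i ↦ (hZ.identDistrib i 0).comp hm
  · exact .of_bound (hm.comp (hZ.measurable 0)).aestronglyMeasurable
      (∑ J, ‖influence a b c J‖) (ae_of_all _ fun ω ↦
        Finset.single_le_sum (f := fun J ↦ ‖influence a b c J‖) (fun _ _ ↦ norm_nonneg _)
          (Finset.mem_univ _))
  · intro t
    rw [hZ.integral_comp 0 fun J ↦ inner ℝ (influence a b c J) t,
      sum_prob_mul_inner_influence hD hb.ne']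
  · intro t
    rw [hZ.integral_comp 0 fun J ↦ (inner ℝ (influence a b c J) t) ^ 2,
      sum_prob_mul_inner_influence_sq hD hb.ne']

theorem IsSample.ae_eventually_pos (ha : 0 < a) (hb : 0 < b) (hc : 0 < c)
    (hdet : 0 ≤ a * c - b ^ 2) (hZ : IsSample P (kernel a b c) Z) :
    ∀ᵐ ω ∂P, ∀ᶠ n in atTop, 0 < empProb Z n ∅ ω ∧ 0 ≤ radicand Z n ω := by
  have hD := normalization_pos ha hc hdet
  filter_upwards [hZ.tendsto_empProb ∅, hZ.tendsto_empProb {0}, hZ.tendsto_empProb {1},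
    hZ.tendsto_empProb {0, 1}] with ω h0 h1 h2 h3
  have hR := (h1.mul h2).sub (h0.mul h3)
  rw [prob_kernel_empty, prob_kernel_zero, prob_kernel_one, prob_kernel_pair] at hR
  rw [prob_kernel_empty] at h0
  refine (h0.eventually_const_lt (by positivity)).and
    ((hR.eventually_const_lt (u := 0) ?_).mono fun n h ↦ h.le)
  rw [show a / ((a + 1) * (c + 1) - b ^ 2) * (c / ((a + 1) * (c + 1) - b ^ 2)) -
    1 / ((a + 1) * (c + 1) - b ^ 2) * ((a * c - b ^ 2) / ((a + 1) * (c + 1) - b ^ 2)) =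
    (b / ((a + 1) * (c + 1) - b ^ 2)) ^ 2 by field_simp; ring]
  positivity

theorem IsSample.tendsto_errorCoeff (ha : 0 < a) (hb : 0 < b) (hc : 0 < c)
    (hdet : 0 ≤ a * c - b ^ 2) (hZ : IsSample P (kernel a b c) Z) :
    ∀ᵐ ω ∂P, Tendsto (fun n ↦ errorCoeff a b c Z n ω) atTop (𝓝 !₂[1, 1, 0]) := by
  have hD := normalization_pos ha hc hdet
  filter_upwards [hZ.tendsto_empProb ∅, hZ.tendsto_empProb {0}, hZ.tendsto_empProb {1},
    hZ.tendsto_empProb {0, 1}] with ω h0 h1 h2 h3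
  rw [prob_kernel_empty] at h0
  rw [prob_kernel_zero] at h1
  rw [prob_kernel_one] at h2
  rw [prob_kernel_pair] at h3
  set D := (a + 1) * (c + 1) - b ^ 2
  have hs : Tendsto (fun n ↦ Real.sqrt (radicand Z n ω)) atTop (𝓝 (b / D)) := by
    have := ((h1.mul h2).sub (h0.mul h3)).sqrt
    rwa [show a / D * (c / D) - 1 / D * ((a * c - b ^ 2) / D) = (b / D) ^ 2 by field_simp; ring,
      Real.sqrt_sq (by positivity)] at this
  have hden := hs.add (h0.const_mul b)
  have hDp := h0.const_mul D
  refine ((PiLp.continuous_toLp 2 _).tendsto _).comp (tendsto_pi_nhds.2 fun i ↦ ?_)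
  fin_cases i
  · have := (tendsto_const_nhds (x := (1 : ℝ))).div hDp (by positivity)
    convert! this using 2
    simp
    field_simp
  · have := (tendsto_const_nhds (x := 2 * b)).div (hden.const_mul D) (by positivity)
    convert! this using 2
    simp
    field_simp
    norm_num
  · have := (h2.sub (h0.const_mul c)).div (hDp.mul hden) (by positivity)
    convert! this using 2
    have hnum : c / D - c * (1 / D) = 0 := by ring
    simp only [hnum, zero_div]
    rfl

theorem IsSample.tendstoInDistribution_estimator (ha : 0 < a) (hb : 0 < b) (hc : 0 < c)
    (hdet : 0 ≤ a * c - b ^ 2) (hZ : IsSample P (kernel a b c) Z) :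
    TendstoInDistribution
      (fun (n : ℕ) (ω : Ω) => Real.sqrt n • (estimator Z n ω - !₂[a, b, c]))
      atTop id (fun _ => P) (multivariateGaussian 0 (asympCov a b c)) := by
  have hD := normalization_pos ha hc hdet
  have hκ (n : ℕ) : AEMeasurable (errorCoeff a b c Z n) P :=
    (hZ.measurable_errorCoeff n).aemeasurable
  have hest (n : ℕ) : AEMeasurable (fun ω ↦ Real.sqrt n • (estimator Z n ω - !₂[a, b, c])) P :=
    (((hZ.measurable_estimator n).sub_const _).const_smul (Real.sqrt n)).aemeasurable
  have hlin := hZ.tendstoInDistribution_influence ha hb hc hdet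
  have key := hlin.continuous_comp_prodMk_of_tendstoInMeasure_const continuous_errorMap
    (tendstoInMeasure_of_tendsto_ae (fun n ↦ (hκ n).aestronglyMeasurable)
      (hZ.tendsto_errorCoeff ha hb hc hdet)) hκ
  have hid : (fun x : EuclideanSpace ℝ (Fin 3) ↦ errorMap (id x, !₂[1, 1, 0])) = id := by
    ext x i
    fin_cases i <;> simp [errorMap]
  rw [hid] at key
  -- The exact formula holds only when `p₀ > 0` and the radicand is nonnegative. Almost surely this
  -- is so for all large `n`, hence the discrepancy is eventually `0`.
  refine tendstoInDistribution_of_tendstoInMeasure_sub _ _ key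
    (tendstoInMeasure_of_tendsto_ae
      (fun n ↦ ((hest n).sub (key.forall_aemeasurable n)).aestronglyMeasurable) ?_) hest
  filter_upwards [hZ.ae_eventually_pos ha hb hc hdet] with ω hω
  refine tendsto_const_nhds.congr' ?_
  filter_upwards [hω] with n hn
  simp [sqrt_smul_estimator_sub hb hD.ne' hn.1 hn.2]

/-! ### Derivatives of the log-likelihood and the inverse Hessian -/

section loglik
variable {q₁ q₂ q₃ : ℝ} {x : EuclideanSpace ℝ (Fin 3)}

/-- The log-likelihood of the two-by-two model with weights `q₁, q₂, q₃` of the nonempty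
subsets. -/
noncomputable def logLik (q₁ q₂ q₃ : ℝ) (θ : EuclideanSpace ℝ (Fin 3)) : ℝ :=
  q₁ * Real.log (θ 0) + q₂ * Real.log (θ 2) + q₃ * Real.log (θ 0 * θ 2 - θ 1 ^ 2) -
    Real.log ((θ 0 + 1) * (θ 2 + 1) - θ 1 ^ 2)

/-- The derivative of `logLik q₁ q₂ q₃` at `θ` in the direction `v`. -/
noncomputable def logLikDeriv (q₁ q₂ q₃ : ℝ) (v θ : EuclideanSpace ℝ (Fin 3)) : ℝ :=
  q₁ * (v 0 / θ 0) + q₂ * (v 2 / θ 2) +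
    q₃ * ((v 0 * θ 2 + θ 0 * v 2 - 2 * θ 1 * v 1) / (θ 0 * θ 2 - θ 1 ^ 2)) -
    (v 0 * (θ 2 + 1) + (θ 0 + 1) * v 2 - 2 * θ 1 * v 1) / ((θ 0 + 1) * (θ 2 + 1) - θ 1 ^ 2)

theorem contDiffAt_logLik {n : WithTop ℕ∞} (h0 : x 0 ≠ 0) (h2 : x 2 ≠ 0)
    (hd : x 0 * x 2 - x 1 ^ 2 ≠ 0) (hD : (x 0 + 1) * (x 2 + 1) - x 1 ^ 2 ≠ 0) :
    ContDiffAt ℝ n (logLik q₁ q₂ q₃) x := by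
  have hp (i : Fin 3) : ContDiffAt ℝ n (fun θ : EuclideanSpace ℝ (Fin 3) ↦ θ i) x := by fun_prop
  exact (((contDiffAt_const.mul ((hp 0).log h0)).add (contDiffAt_const.mul ((hp 2).log h2))).add
    (contDiffAt_const.mul ((((hp 0).mul (hp 2)).sub ((hp 1).pow 2)).log hd))).sub
    (((((hp 0).add contDiffAt_const).mul ((hp 2).add contDiffAt_const)).sub ((hp 1).pow 2)).log hD)

theorem hasDerivAt_coord (x v : EuclideanSpace ℝ (Fin 3)) (i : Fin 3) :
    HasDerivAt (fun t : ℝ ↦ (x + t • v) i) (v i) 0 := by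
  simpa using ((hasDerivAt_id (0 : ℝ)).mul_const (v i)).const_add (x i)

theorem fderiv_logLik (v : EuclideanSpace ℝ (Fin 3)) (h0 : x 0 ≠ 0) (h2 : x 2 ≠ 0)
    (hd : x 0 * x 2 - x 1 ^ 2 ≠ 0) (hD : (x 0 + 1) * (x 2 + 1) - x 1 ^ 2 ≠ 0) :
    fderiv ℝ (logLik q₁ q₂ q₃) x v = logLikDeriv q₁ q₂ q₃ v x := by
  rw [← ((contDiffAt_logLik (n := 1) h0 h2 hd hD).differentiableAt
    one_ne_zero).lineDeriv_eq_fderiv]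
  refine HasLineDerivAt.lineDeriv (?_ : HasDerivAt _ _ _)
  have c0 := hasDerivAt_coord x v 0
  have c1 := hasDerivAt_coord x v 1
  have c2 := hasDerivAt_coord x v 2
  have := (((c0.log (by simpa using h0)).const_mul q₁).add
    ((c2.log (by simpa using h2)).const_mul q₂)).add
    ((((c0.mul c2).sub (c1.pow 2)).log (by simpa using hd)).const_mul q₃) |>.sub
    ((((c0.add_const 1).mul (c2.add_const 1)).sub (c1.pow 2)).log (by simpa using hD))
  refine this.congr_deriv ?_
  simp [logLikDeriv]

theorem differentiableAt_logLikDeriv (v : EuclideanSpace ℝ (Fin 3)) (h0 : x 0 ≠ 0) (h2 : x 2 ≠ 0)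
    (hd : x 0 * x 2 - x 1 ^ 2 ≠ 0) (hD : (x 0 + 1) * (x 2 + 1) - x 1 ^ 2 ≠ 0) :
    DifferentiableAt ℝ (logLikDeriv q₁ q₂ q₃ v) x := by
  unfold logLikDeriv
  fun_prop (disch := assumption)

theorem fderiv_logLikDeriv (v w : EuclideanSpace ℝ (Fin 3)) (h0 : x 0 ≠ 0) (h2 : x 2 ≠ 0)
    (hd : x 0 * x 2 - x 1 ^ 2 ≠ 0) (hD : (x 0 + 1) * (x 2 + 1) - x 1 ^ 2 ≠ 0) :
    fderiv ℝ (logLikDeriv q₁ q₂ q₃ v) x w =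
      q₁ * (-(v 0 * w 0) / x 0 ^ 2) + q₂ * (-(v 2 * w 2) / x 2 ^ 2) +
      q₃ * ((v 0 * w 2 + w 0 * v 2 - 2 * w 1 * v 1) / (x 0 * x 2 - x 1 ^ 2) -
        (v 0 * x 2 + x 0 * v 2 - 2 * x 1 * v 1) * (w 0 * x 2 + x 0 * w 2 - 2 * x 1 * w 1) /
          (x 0 * x 2 - x 1 ^ 2) ^ 2) -
      ((v 0 * w 2 + w 0 * v 2 - 2 * w 1 * v 1) / ((x 0 + 1) * (x 2 + 1) - x 1 ^ 2) -
        (v 0 * (x 2 + 1) + (x 0 + 1) * v 2 - 2 * x 1 * v 1) *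
          (w 0 * (x 2 + 1) + (x 0 + 1) * w 2 - 2 * x 1 * w 1) /
          ((x 0 + 1) * (x 2 + 1) - x 1 ^ 2) ^ 2) := by
  rw [← (differentiableAt_logLikDeriv v h0 h2 hd hD).lineDeriv_eq_fderiv]
  refine HasLineDerivAt.lineDeriv (?_ : HasDerivAt _ _ _)
  have c0 := hasDerivAt_coord x w 0
  have c1 := hasDerivAt_coord x w 1
  have c2 := hasDerivAt_coord x w 2
  have := ((((hasDerivAt_const 0 (v 0)).div c0 (by simpa using h0)).const_mul q₁).add
    (((hasDerivAt_const 0 (v 2)).div c2 (by simpa using h2)).const_mul q₂)).add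
    ((((c2.const_mul (v 0)).add (c0.mul_const (v 2))).sub
      ((c1.const_mul 2).mul_const (v 1))).div ((c0.mul c2).sub (c1.pow 2))
        (by simpa using hd) |>.const_mul q₃) |>.sub
    (((((c2.add_const 1).const_mul (v 0)).add ((c0.add_const 1).mul_const (v 2))).sub
      ((c1.const_mul 2).mul_const (v 1))).div
        (((c0.add_const 1).mul (c2.add_const 1)).sub (c1.pow 2)) (by simpa using hD))
  refine this.congr_deriv ?_
  simp
  field_simp

theorem hessian_logLik (h0 : x 0 ≠ 0) (h2 : x 2 ≠ 0)
    (hd : x 0 * x 2 - x 1 ^ 2 ≠ 0) (hD : (x 0 + 1) * (x 2 + 1) - x 1 ^ 2 ≠ 0) (i j : Fin 3) :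
    hessian (logLik q₁ q₂ q₃) x i j =
      fderiv ℝ (logLikDeriv q₁ q₂ q₃ (EuclideanSpace.single j 1)) x
        (EuclideanSpace.single i 1) := by
  rw [hessian, Matrix.of_apply]
  congr 1
  -- The nonvanishing conditions are open, so the first-derivative formula holds near `x` and may be
  -- differentiated again.
  refine Filter.EventuallyEq.fderiv_eq ?_
  have hc {f : EuclideanSpace ℝ (Fin 3) → ℝ} (hf : Continuous f) (h : f x ≠ 0) :
      ∀ᶠ y in 𝓝 x, f y ≠ 0 := hf.continuousAt.eventually_ne h
  filter_upwards [hc (f := fun y ↦ y 0) (by fun_prop) h0, hc (f := fun y ↦ y 2) (by fun_prop) h2,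
    hc (f := fun y ↦ y 0 * y 2 - y 1 ^ 2) (by fun_prop) hd,
    hc (f := fun y ↦ (y 0 + 1) * (y 2 + 1) - y 1 ^ 2) (by fun_prop) hD] with y k0 k2 kd kD
  exact fderiv_logLik _ k0 k2 kd kD

end loglik

variable {a b c : ℝ}

theorem expLogLik₂_eq_logLik (a b c : ℝ) : expLogLik₂ a b c =
    logLik (prob (kernel a b c) {0}) (prob (kernel a b c) {1}) (prob (kernel a b c) {0, 1}) :=
  funext (expLogLik₂_eq a b c)

/-- The Hessian of the expected log-likelihood at the true parameter. -/
theorem hessian_expLogLik₂ (ha : 0 < a) (hc : 0 < c) (hdet : 0 < a * c - b ^ 2) :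
    hessian (expLogLik₂ a b c) !₂[a, b, c] =
      let D := (a + 1) * (c + 1) - b ^ 2
      let d := a * c - b ^ 2
      !![-1 / (a * D) - c ^ 2 / (d * D) + (c + 1) ^ 2 / D ^ 2,
          2 * b * (c ^ 2 + c + b ^ 2) / (d * D ^ 2),
          -(a * c) / (d * D) + (a + 1) * (c + 1) / D ^ 2;
        2 * b * (c ^ 2 + c + b ^ 2) / (d * D ^ 2),
          -(4 * b ^ 2 * (a + c + 1)) / (d * D ^ 2),
          2 * b * (a ^ 2 + a + b ^ 2) / (d * D ^ 2);
        -(a * c) / (d * D) + (a + 1) * (c + 1) / D ^ 2,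
          2 * b * (a ^ 2 + a + b ^ 2) / (d * D ^ 2),
          -1 / (c * D) - a ^ 2 / (d * D) + (a + 1) ^ 2 / D ^ 2] := by
  have hD := normalization_pos ha hc hdet.le
  have hd' := hdet.ne'
  have hD' := hD.ne'
  rw [expLogLik₂_eq_logLik]
  ext i j
  rw [hessian_logLik (x := !₂[a, b, c]) ha.ne' hc.ne' hd' hD',
    fderiv_logLikDeriv (x := !₂[a, b, c]) _ _ ha.ne' hc.ne' hd' hD',
    prob_kernel_zero, prob_kernel_one, prob_kernel_pair]
  simp only [Matrix.of_apply]
  fin_cases i <;> fin_cases j <;> simp <;> field_simp <;> ring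

/-- For square matrices a right inverse is the inverse, so this one identity gives both
invertibility and the value of the inverse. -/
theorem hessian_mul_neg_asympCov (ha : 0 < a) (hb : 0 < b) (hc : 0 < c)
    (hdet : 0 < a * c - b ^ 2) :
    hessian (expLogLik₂ a b c) !₂[a, b, c] * -asympCov a b c = 1 := by
  have hd' := hdet.ne'
  have hD' := (normalization_pos ha hc hdet.le).ne'
  have hd'' : c * a - b ^ 2 ≠ 0 := by rwa [mul_comm c a]
  have hD'' : (c + 1) * (a + 1) - b ^ 2 ≠ 0 := by rwa [mul_comm (c + 1)]
  rw [hessian_expLogLik₂ ha hc hdet]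
  ext i j
  rw [Matrix.mul_apply, Fin.sum_univ_three]
  fin_cases i <;> fin_cases j <;> simp [asympCov] <;> field_simp <;> ring

theorem contDiffAt_expLogLik₂ {n : WithTop ℕ∞} (ha : 0 < a) (hc : 0 < c)
    (hdet : 0 < a * c - b ^ 2) : ContDiffAt ℝ n (expLogLik₂ a b c) !₂[a, b, c] := by
  rw [expLogLik₂_eq_logLik]
  exact contDiffAt_logLik (x := !₂[a, b, c]) ha.ne' hc.ne' hdet.ne'
    (normalization_pos ha hc hdet.le).ne'

theorem isUnit_det_hessian (ha : 0 < a) (hb : 0 < b) (hc : 0 < c) (hdet : 0 < a * c - b ^ 2) :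
    IsUnit (hessian (expLogLik₂ a b c) !₂[a, b, c]).det :=
  Matrix.isUnit_det_of_right_inverse (hessian_mul_neg_asympCov ha hb hc hdet)

theorem neg_invHessian (ha : 0 < a) (hb : 0 < b) (hc : 0 < c) (hdet : 0 < a * c - b ^ 2) :
    -invHessian a b c = asympCov a b c := by
  rw [invHessian, Matrix.inv_eq_right_inv (hessian_mul_neg_asympCov ha hb hc hdet), neg_neg]

end DPP

theorem theorem5p1 {Ω : Type*} [MeasurableSpace Ω] (P : Measure Ω) [IsProbabilityMeasure P]
    (a b c : ℝ) (ha : 0 < a) (hb : 0 < b) (hc : 0 < c) (hdet : 0 ≤ a * c - b ^ 2)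
    (Z : ℕ → Ω → Finset (Fin 2)) (hZ : DPP.IsSample P (DPP.kernel a b c) Z) :
    -- almost surely, the estimator is well defined for all large sample sizes
    (∀ᵐ ω ∂P, ∀ᶠ n in atTop, 0 < DPP.empProb Z n ∅ ω ∧ 0 ≤ DPP.radicand Z n ω) ∧
    -- asymptotic normality, with the covariance matrix in explicit form
    (DPP.asympCov a b c).PosSemidef ∧
    TendstoInDistribution
      (fun (n : ℕ) (ω : Ω) => Real.sqrt n • (DPP.estimator Z n ω - !₂[a, b, c]))
      atTop id (fun _ => P) (multivariateGaussian 0 (DPP.asympCov a b c)) ∧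
    -- the expected log-likelihood in explicit form
    (∀ θ : EuclideanSpace ℝ (Fin 3), DPP.expLogLik₂ a b c θ =
      DPP.prob (DPP.kernel a b c) {0} * Real.log (θ 0) +
      DPP.prob (DPP.kernel a b c) {1} * Real.log (θ 2) +
      DPP.prob (DPP.kernel a b c) {0, 1} * Real.log (θ 0 * θ 2 - θ 1 ^ 2) -
      Real.log ((θ 0 + 1) * (θ 2 + 1) - θ 1 ^ 2)) ∧
    -- for a positive definite kernel, the covariance is minus the inverse Hessian of the
    -- expected log-likelihood at the true parameter
    (0 < a * c - b ^ 2 →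
      ContDiffAt ℝ 2 (DPP.expLogLik₂ a b c) !₂[a, b, c] ∧
      IsUnit (DPP.hessian (DPP.expLogLik₂ a b c) !₂[a, b, c]).det ∧
      -DPP.invHessian a b c = DPP.asympCov a b c ∧
      TendstoInDistribution
        (fun (n : ℕ) (ω : Ω) => Real.sqrt n • (DPP.estimator Z n ω - !₂[a, b, c]))
        atTop id (fun _ => P) (multivariateGaussian 0 (-DPP.invHessian a b c))) := by
  refine ⟨hZ.ae_eventually_pos ha hb hc hdet, DPP.posSemidef_asympCov ha hb hc hdet,
    hZ.tendstoInDistribution_estimator ha hb hc hdet, DPP.expLogLik₂_eq a b c, fun hpos ↦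
    ⟨DPP.contDiffAt_expLogLik₂ ha hc hpos, DPP.isUnit_det_hessian ha hb hc hpos,
      DPP.neg_invHessian ha hb hc hpos, ?_⟩⟩
  rw [DPP.neg_invHessian ha hb hc hpos]
  exact hZ.tendstoInDistribution_estimator ha hb hc hdet
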